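/- Let $\mathbb S^1=\mathbb R/\mathbb Z$, let $\alpha\in\mathbb R$ (rational or irrational) and let $f(x)=x+\alpha \bmod 1$. Let $\varepsilon>0$, let $\vartheta_\varepsilon$ be the uniform distribution on $[-\varepsilon,\varepsilon]$, put $f_\omega(x)=f(x)+\omega \bmod 1$ and, for $\underline\omega=(\omega_1,\omega_2,\dots)$, $f^n_{\underline\omega}=f_{\omega_n}\circ\cdots\circ f_{\omega_1}$, $f^0_{\underline\omega}=\mathrm{id}$. Let $\mu_\varepsilon$ be a stationary probability measure, i.e. a Borel probability measure on $\mathbb S^1$ with $\iint \phi(f_\omega(x))\,d\vartheta_\varepsilon(\omega)\,d\mu_\varepsilon(x)=\int\phi\,d\mu_\varepsilon$ for all bounded measurable $\phi:\mathbb S^1\to\mathbb R$, and let $\mathbb P=\mu_\varepsilon\times\vartheta_\varepsilon^{\mathbb N}$. Let $\varphi:\mathbb S^1\to\mathbb R\cup\{+\infty\}$ be a measurable observable, and put $X_n=\varphi\circ f^n_{\underline\omega}$ for $n\ge 0$, $M_n=\max\{X_0,\dots,X_{n-1}\}$ for $n\ge1$ (with $M_0=-\infty$). Let $\tau>0$,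 $z\in\mathbb S^1$, and let $(u_n)_{n\in\mathbb N}$ be real numbers with $n\,\mathbb P(X_0>u_n)\to\tau$ as $n\to\infty$ and $\bigcap_{n\in\mathbb N}\{x:\varphi(x)>u_n\}=\{z\}$. Then: 1. There is a sequence of integers $t_n\ge 0$ with $t_n=o(n)$ for which both of the following conditions hold. * $D_2(u_n)$: there is $\gamma(n,t)$, non-increasing in $t$ for each $n$, with $n\gamma(n,t_n)\to0$, such that for all integers $\ell,t,n\ge0$ $$\bigl|\mathbb P(X_0>u_n,\ \max\{X_t,\dots,X_{t+\ell-1}\}\le u_n)-\mathbb P(X_0>u_n)\,\mathbb P(M_\ell\le u_n)\bigr|\le\gamma(n,t).$$ * $D'(u_n)$: there are integers $k_n\to\infty$ with $k_nt_n=o(n)$ and $$\lim_{n\to\infty} n\sum_{j=1}^{\lfloor n/k_n\rfloor}\mathbb P(X_0>u_n,\ X_j>u_n)=0.$$ 2. $\mathbb P(M_n\le u_n)\to e^{-\tau}$ as $n\to\infty$. 3. There is an extreme value law for $M_n$ with extremal index $1$: there is a non-degenerate distribution function $H$ with $H(0)=0$ and $1-H(\sigma)=e^{-\sigma}$ for all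 $\sigma>0$ such that for every $\sigma>0$ there are real levels $v_n$ with $n\,\mathbb P(X_0>v_n)\to\sigma$ and, if $\sigma$ is a continuity point of $H$, $\mathbb P(M_n\le v_n)\to 1-H(\sigma)$. -/

import Mathlib

open MeasureTheory Filter Topology

noncomputable section

namespace ExtremeValue

/-! ### Extreme values of a stochastic process `X₀, X₁, …` on a probability space `(Ω, P)`.
Observations take values in the extended reals, levels are real numbers. -/

section StochProc

variable {Ω : Type*} [MeasurableSpace Ω]

/-- `max {X_t, …, X_{t+ℓ-1}}`; the maximum of no observations is `-∞`. -/
def windowMax (X : ℕ → Ω → EReal) (t l : ℕ) (ω : Ω) : EReal :=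
  (Finset.range l).sup fun i => X (t + i) ω

/-- `M_n = max {X_0, …, X_{n-1}}`. -/
def partialMax (X : ℕ → Ω → EReal) (n : ℕ) (ω : Ω) : EReal :=
  (Finset.range n).sup fun i => X i ω

/-- Condition `D₂(u_n)`, the gap sequence `t_n` being `t`. -/
def CondD2With (P : Measure Ω) (X : ℕ → Ω → EReal) (u : ℕ → ℝ) (t : ℕ → ℕ) : Prop :=
  (fun n => (t n : ℝ)) =o[atTop] (fun n : ℕ => (n : ℝ)) ∧
  ∃ γ : ℕ → ℕ → ℝ,
    (∀ n, Antitone (γ n)) ∧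
    (∀ l s n : ℕ,
      |P.real {ω | (u n : EReal) < X 0 ω ∧ windowMax X s l ω ≤ (u n : EReal)}
        - P.real {ω | (u n : EReal) < X 0 ω} * P.real {ω | partialMax X l ω ≤ (u n : EReal)}|
        ≤ γ n s) ∧
    Tendsto (fun n : ℕ => (n : ℝ) * γ n (t n)) atTop (𝓝 0)

/-- Condition `D'(u_n)`, relative to the gap sequence `t_n` of condition `D₂(u_n)`. -/
def CondDPrimeWith (P : Measure Ω) (X : ℕ → Ω → EReal) (u : ℕ → ℝ) (t : ℕ → ℕ) : Prop :=
  ∃ k : ℕ → ℕ,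
    Tendsto k atTop atTop ∧
    (fun n => (k n : ℝ) * (t n : ℝ)) =o[atTop] (fun n : ℕ => (n : ℝ)) ∧
    Tendsto (fun n : ℕ => (n : ℝ) * ∑ j ∈ Finset.Icc 1 (n / k n),
      P.real {ω | (u n : EReal) < X 0 ω ∧ (u n : EReal) < X j ω}) atTop (𝓝 0)

/-- Distribution functions of probability laws on the real line. -/
structure IsDistributionFunction (H : ℝ → ℝ) : Prop where
  mono : Monotone H
  right_cts : ∀ x, ContinuousWithinAt H (Set.Ici x) x
  tendsto_bot : Tendsto H atBot (𝓝 0)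
  tendsto_top : Tendsto H atTop (𝓝 1)

/-- There is an extreme value law for `M_n`, with distribution function `H`. Nondegenerate means
that the law is not a point mass. -/
def HasEVL (P : Measure Ω) (X : ℕ → Ω → EReal) (H : ℝ → ℝ) : Prop :=
  IsDistributionFunction H ∧ (∃ x, 0 < H x ∧ H x < 1) ∧ H 0 = 0 ∧
  ∀ τ : ℝ, 0 < τ → ∃ u : ℕ → ℝ,
    Tendsto (fun n : ℕ => (n : ℝ) * P.real {ω | (u n : EReal) < X 0 ω}) atTop (𝓝 τ) ∧
    (ContinuousAt H τ →
      Tendsto (fun n : ℕ => P.real {ω | partialMax X n ω ≤ (u n : EReal)}) atTop (𝓝 (1 - H τ)))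

/-- The process has extremal index `θ`. -/
def HasExtremalIndex (P : Measure Ω) (X : ℕ → Ω → EReal) (θ : ℝ) : Prop :=
  0 ≤ θ ∧ θ ≤ 1 ∧
  ∃ H : ℝ → ℝ, HasEVL P X H ∧ ∀ τ : ℝ, 0 < τ → 1 - H τ = Real.exp (-(θ * τ))

end StochProc

/-! ### Rotations of the circle `ℝ / ℤ` with additive noise -/

/-- The rotation `f(x) = x + a mod 1`. -/
def rotation (a : ℝ) (x : UnitAddCircle) : UnitAddCircle := x + (a : UnitAddCircle)

/-- The perturbed map `f_w(x) = f(x) + w mod 1`. -/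
def perturbed (a w : ℝ) (x : UnitAddCircle) : UnitAddCircle :=
  rotation a x + (w : UnitAddCircle)

/-- The random orbit `f^n_w(x)`, a concatenation of `n` perturbed maps. The coordinate `w k` is the
noise of step `k + 1`. -/
def randomOrbit (a : ℝ) : ℕ → (ℕ → ℝ) → UnitAddCircle → UnitAddCircle
  | 0, _, x => x
  | n + 1, w, x => perturbed a (w n) (randomOrbit a n w x)

/-- The noise distribution: the uniform law on `[-ε, ε]`. -/
def noise (ε : ℝ) : Measure ℝ := ProbabilityTheory.cond volume (Set.Icc (-ε) ε)

theorem isProbabilityMeasure_noise {ε : ℝ} (hε : 0 < ε) : IsProbabilityMeasure (noise ε) := by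
  apply ProbabilityTheory.cond_isProbabilityMeasure_of_finite
  · rw [Real.volume_Icc]
    simp only [ne_eq, ENNReal.ofReal_eq_zero, not_le]
    linarith
  · rw [Real.volume_Icc]
    exact ENNReal.ofReal_ne_top

/-- The random evolution operator. -/
def evolutionOp (a ε : ℝ) (g : UnitAddCircle → ℝ) (x : UnitAddCircle) : ℝ :=
  ∫ w, g (perturbed a w x) ∂(noise ε)

/-- `μ` is a stationary measure of the randomly perturbed rotation. -/
def IsStationary (a ε : ℝ) (μ : Measure UnitAddCircle) : Prop :=
  ∀ g : UnitAddCircle → ℝ, Measurable g → (∃ C, ∀ x, |g x| ≤ C) →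
    ∫ x, evolutionOp a ε g x ∂μ = ∫ x, g x ∂μ

/-- The measure `μ × ϑ_ε^ℕ` on pairs (initial state, noise sequence). -/
def orbitMeasure (ε : ℝ) (μ : Measure UnitAddCircle) : Measure (UnitAddCircle × (ℕ → ℝ)) :=
  μ.prod (Measure.infinitePi fun _ : ℕ => noise ε)

/-- The process `X_n = φ ∘ f^n_w`. -/
def process (a : ℝ) (φ : UnitAddCircle → EReal) (n : ℕ) (p : UnitAddCircle × (ℕ → ℝ)) : EReal :=
  φ (randomOrbit a n p.2 p.1)

end ExtremeValue

end

/-!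
The starting point is that the random evolution operator `Q` is governed by two elementary estimates
on its kernel. The noise interval is covered by `⌈2ε⌉` periods, so one step has a bounded density with
respect to Lebesgue measure (`evolutionOp_le`). Conversely the `k`-step density is bounded below on
an interval whose half length grows linearly in `k`
(`exists_mul_integral_le_evolutionOp_iterate`), and this interval eventually covers the circle, so
some power of the kernel dominates a multiple `c` of Lebesgue measure (`exists_doeblin`). Integrating
the second estimate against the stationary measure `μ` gives `μ ≥ c • volume`, whence the kernel also
has a bounded density with respect to `μ`; and the second estimate makes `Q ^ m` contract
oscillations by the factor `1 - c`, so that `Q ^ s g` converges to `∫ g dμ` uniformly and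
geometrically (`IsStationary.exists_bounds`). The arithmetic of the rotation angle plays no role.

By the Markov property (`orbitMeasure_real_inter_skew`) these estimates become the two
`MixingBounds` on the orbit measure. Write `p` for `P(X₀ > u)`. Decorrelation gives `D₂` with
`γ(n, t) = p ρ ^ (t / m)`, and `P(X₀ > u, X_j > u) ≤ B p ^ 2` for all `j ≥ 1` gives `D'`, for the
choice `t_n = ⌊√n⌋` and `k_n = ⌊√t_n⌋`.

For the limit law no blocks are needed. With `a_l = P(M_l ≤ u)`, stationarity gives
`a_{l+1} = a_l - P(X₀ > u, X₁, …, X_l ≤ u)`. Moving the window from time `1` to time `s` costs at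
most `s B p ^ 2`, after which decorrelation replaces the last probability by `p a_l`. Hence `a_n`
differs from `(1 - p) ^ n` by at most `n (s B p ^ 2 + p ρ ^ (s / m))`
(`MixingBounds.abs_partialMax_sub_pow_le`), which tends to `0` for `s = ⌊√n⌋`, while
`(1 - p) ^ n` tends to `exp (-τ)`. This argument applies to any levels with
`n P(X₀ > v_n) → σ`, and such levels exist for every `σ > 0` as a reindexing of the given ones.
-/

namespace ExtremeValue

/-! ### Bounded measurable functions -/

/-- Bounded measurable real functions, the test functions in the definition of stationarity. -/
def BddMeas {S : Type*} [MeasurableSpace S] (g : S → ℝ) : Prop :=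
  Measurable g ∧ ∃ C, ∀ x, |g x| ≤ C

section BddMeas

variable {S : Type*} [MeasurableSpace S] {g h : S → ℝ}

theorem BddMeas.integrable (hg : BddMeas g) (ν : Measure S) [IsFiniteMeasure ν] :
    Integrable g ν := by
  obtain ⟨hm, C, hC⟩ := hg
  exact .of_bound hm.aestronglyMeasurable C (ae_of_all _ hC)

theorem BddMeas.comp {S' : Type*} [MeasurableSpace S'] (hg : BddMeas g) {f : S' → S}
    (hf : Measurable f) : BddMeas (g ∘ f) :=
  ⟨hg.1.comp hf, hg.2.imp fun _ hC x => hC (f x)⟩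

theorem BddMeas.integral_prod_right {S' : Type*} [MeasurableSpace S'] {f : S' × S → ℝ}
    (hf : BddMeas f) (ν : Measure S) [IsProbabilityMeasure ν] :
    BddMeas fun x => ∫ y, f (x, y) ∂ν := by
  obtain ⟨hm, C, hC⟩ := hf
  refine ⟨hm.stronglyMeasurable.integral_prod_right'.measurable, C, fun x => ?_⟩
  have := norm_integral_le_of_norm_le_const (μ := ν) (f := fun y => f (x, y))
    (ae_of_all _ fun y => hC (x, y))
  simpa using this

theorem BddMeas.of_mem_Icc (hm : Measurable g) {m M : ℝ} (hg : ∀ x, g x ∈ Set.Icc m M) :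
    BddMeas g :=
  ⟨hm, max |m| |M|, fun x => abs_le_max_abs_abs (hg x).1 (hg x).2⟩

theorem bddMeas_const (c : ℝ) : BddMeas fun _ : S => c :=
  ⟨measurable_const, |c|, fun _ => le_rfl⟩

theorem BddMeas.sub (hg : BddMeas g) (hh : BddMeas h) : BddMeas fun x => g x - h x := by
  obtain ⟨hm, C, hC⟩ := hg
  obtain ⟨hm', C', hC'⟩ := hh
  exact ⟨hm.sub hm', C + C', fun x => (abs_sub _ _).trans (add_le_add (hC x) (hC' x))⟩

theorem bddMeas_indicator_one {U : Set S} (hU : MeasurableSet U) :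
    BddMeas (U.indicator (1 : S → ℝ)) :=
  .of_mem_Icc (measurable_one.indicator hU) (m := 0) (M := 1) fun x =>
    ⟨Set.indicator_nonneg (fun _ _ => zero_le_one) x,
      Set.indicator_le_self' (fun _ _ => zero_le_one) x⟩

end BddMeas

/-! ### The random evolution operator -/

theorem integral_noise {ε : ℝ} (hε : 0 < ε) (f : ℝ → ℝ) :
    ∫ w, f w ∂(noise ε) = (2 * ε)⁻¹ * ∫ w in -ε..ε, f w := by
  rw [noise, ProbabilityTheory.cond, integral_smul_measure, Real.volume_Icc,
    integral_Icc_eq_integral_Ioc, intervalIntegral.integral_of_le (by linarith), ENNReal.toReal_inv,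
    ENNReal.toReal_ofReal (by linarith), smul_eq_mul]
  congr 2
  ring

theorem evolutionOp_coe {a ε : ℝ} (hε : 0 < ε) (g : UnitAddCircle → ℝ) (t : ℝ) :
    evolutionOp a ε g (t : UnitAddCircle) =
      (2 * ε)⁻¹ * ∫ s in (t + a - ε)..(t + a + ε), g (s : UnitAddCircle) := by
  rw [evolutionOp, integral_noise hε]
  congr 1
  have := intervalIntegral.integral_comp_add_left (a := -ε) (b := ε)
    (fun s : ℝ => g (s : UnitAddCircle)) (t + a)
  rw [← sub_eq_add_neg] at this
  rw [← this]
  simp [perturbed, rotation]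

theorem measurable_perturbed (a : ℝ) :
    Measurable fun q : UnitAddCircle × ℝ => perturbed a q.2 q.1 := by
  unfold perturbed rotation
  exact (measurable_fst.add_const _).add (AddCircle.measurable_mk'.comp measurable_snd)

section Evolution

variable {a ε : ℝ} {g h : UnitAddCircle → ℝ}

theorem BddMeas.perturbed (hg : BddMeas g) (x : UnitAddCircle) :
    BddMeas fun w => g (perturbed a w x) :=
  hg.comp ((measurable_perturbed a).comp measurable_prodMk_left)

theorem BddMeas.evolutionOp (hε : 0 < ε) (hg : BddMeas g) : BddMeas (evolutionOp a ε g) := by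
  have := isProbabilityMeasure_noise hε
  exact BddMeas.integral_prod_right (hg.comp (measurable_perturbed a)) (noise ε)

theorem BddMeas.evolutionOp_iterate (hε : 0 < ε) (hg : BddMeas g) (k : ℕ) :
    BddMeas ((ExtremeValue.evolutionOp a ε)^[k] g) := by
  induction k with
  | zero => exact hg
  | succ k ih => rw [Function.iterate_succ_apply']; exact ih.evolutionOp hε

theorem evolutionOp_mono (hε : 0 < ε) (hg : BddMeas g) (hh : BddMeas h) (hgh : ∀ x, g x ≤ h x)
    (x : UnitAddCircle) : evolutionOp a ε g x ≤ evolutionOp a ε h x := by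
  have := isProbabilityMeasure_noise hε
  exact integral_mono ((hg.perturbed x).integrable _) ((hh.perturbed x).integrable _)
    fun w => hgh _

theorem evolutionOp_const (hε : 0 < ε) (c : ℝ) :
    evolutionOp a ε (fun _ => c) = fun _ => c := by
  have := isProbabilityMeasure_noise hε
  ext x
  simp [evolutionOp]

theorem evolutionOp_iterate_const (hε : 0 < ε) (c : ℝ) (k : ℕ) :
    (evolutionOp a ε)^[k] (fun _ => c) = fun _ => c :=
  Function.iterate_fixed (evolutionOp_const hε c) k

theorem evolutionOp_sub (hε : 0 < ε) (hg : BddMeas g) (hh : BddMeas h) :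
    evolutionOp a ε (fun x => g x - h x) =
      fun x => evolutionOp a ε g x - evolutionOp a ε h x := by
  have := isProbabilityMeasure_noise hε
  ext x
  exact integral_sub ((hg.perturbed x).integrable _) ((hh.perturbed x).integrable _)

theorem evolutionOp_iterate_sub (hε : 0 < ε) (hg : BddMeas g) (hh : BddMeas h) (k : ℕ) :
    (evolutionOp a ε)^[k] (fun x => g x - h x) =
      fun x => (evolutionOp a ε)^[k] g x - (evolutionOp a ε)^[k] h x := by
  induction k with
  | zero => rfl
  | succ k ih =>
    simp only [Function.iterate_succ_apply']
    rw [ih, evolutionOp_sub hε (hg.evolutionOp_iterate hε k) (hh.evolutionOp_iterate hε k)]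

theorem evolutionOp_iterate_mem_Icc (hε : 0 < ε) (hm : Measurable g) {m M : ℝ}
    (hg : ∀ x, g x ∈ Set.Icc m M) (k : ℕ) (x : UnitAddCircle) :
    (evolutionOp a ε)^[k] g x ∈ Set.Icc m M := by
  induction k generalizing x with
  | zero => exact hg x
  | succ k ih =>
    have hb : BddMeas ((evolutionOp a ε)^[k] g) :=
      (BddMeas.of_mem_Icc hm hg).evolutionOp_iterate hε k
    rw [Function.iterate_succ_apply']
    constructor
    · have := evolutionOp_mono (a := a) hε (bddMeas_const m) hb (fun x => (ih x).1) x
      rwa [evolutionOp_const hε] at this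
    · have := evolutionOp_mono (a := a) hε hb (bddMeas_const M) (fun x => (ih x).2) x
      rwa [evolutionOp_const hε] at this

theorem BddMeas.intervalIntegrable (hg : BddMeas g) (s t : ℝ) :
    IntervalIntegrable (fun r : ℝ => g (r : UnitAddCircle)) volume s t :=
  ⟨(hg.comp AddCircle.measurable_mk').integrable _, (hg.comp AddCircle.measurable_mk').integrable _⟩

/-- The transition kernel has a density bounded by `⌈2ε⌉ / (2ε)`: the noise interval is covered
by `⌈2ε⌉` periods. -/
theorem evolutionOp_le (hε : 0 < ε) (hg : BddMeas g) (h0 : ∀ x, 0 ≤ g x) (x : UnitAddCircle) :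
    evolutionOp a ε g x ≤ (2 * ε)⁻¹ * ⌈2 * ε⌉₊ * ∫ y, g y := by
  induction x using QuotientAddGroup.induction_on with
  | H t =>
  have hN := Nat.le_ceil (2 * ε)
  have hper : Function.Periodic (fun r : ℝ => g (r : UnitAddCircle)) 1 := fun r => by simp
  have h1 := hper.intervalIntegral_add_zsmul_eq ⌈2 * ε⌉₊ (t + a - ε)
    hg.intervalIntegrable
  have h2 := UnitAddCircle.intervalIntegral_preimage (t + a - ε) g
  refine (evolutionOp_coe hε g t).trans_le ?_
  rw [mul_assoc]
  gcongr
  calc ∫ s in (t + a - ε)..(t + a + ε), g (s : UnitAddCircle)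
      ≤ ∫ s in (t + a - ε)..(t + a - ε + ⌈2 * ε⌉₊), g (s : UnitAddCircle) :=
        intervalIntegral.integral_mono_interval le_rfl (by linarith) (by linarith)
          (ae_of_all _ fun s => h0 _) (hg.intervalIntegrable _ _)
    _ = ⌈2 * ε⌉₊ * ∫ y, g y := by
        rw [← h2]
        simpa using h1

/-- A lower bound for the `k`-step kernel on an interval whose half length grows by `ε / 2` at each
step. -/
theorem exists_mul_integral_le_evolutionOp_iterate (hε : 0 < ε) (k : ℕ) :
    ∃ c : ℝ, 0 < c ∧ ∀ g : UnitAddCircle → ℝ, BddMeas g → (∀ x, 0 ≤ g x) → ∀ t : ℝ,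
      c * ∫ s in (t + (k + 1) * a - (ε + k * (ε / 2)))..(t + (k + 1) * a + (ε + k * (ε / 2))),
        g (s : UnitAddCircle) ≤ (evolutionOp a ε)^[k + 1] g (t : UnitAddCircle) := by
  induction k with
  | zero =>
    refine ⟨(2 * ε)⁻¹, by positivity, fun g _ _ t => ?_⟩
    simp [evolutionOp_coe hε]
  | succ k ih =>
    obtain ⟨c, hc, H⟩ := ih
    refine ⟨c / 4, by positivity, fun g hg h0 t => ?_⟩
    rw [Function.iterate_succ_apply', evolutionOp_coe hε]
    have hQ := hg.evolutionOp_iterate (a := a) hε (k + 1)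
    have hQ0 : ∀ x, 0 ≤ (evolutionOp a ε)^[k + 1] g x := by
      obtain ⟨hm, C, hC⟩ := hg
      exact fun x => (evolutionOp_iterate_mem_Icc hε hm (m := 0) (M := C)
        (fun x => ⟨h0 x, (le_abs_self _).trans (hC x)⟩) (k + 1) x).1
    have hk : 0 ≤ k * (ε / 2) := by positivity
    push_cast
    -- The noise is split: values in `[-ε, -ε/2]` reach the left half of the new interval, values in
    -- `[ε/2, ε]` the right half.
    set y := t + (k + 1 + 1) * a with hy
    set r := ε + (k + 1) * (ε / 2) with hr
    have hI := hg.intervalIntegrable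
    have key : ∀ s₀ s₁ l₀ l₁ : ℝ, s₁ = s₀ + ε / 2 → l₀ ≤ l₁ →
        (∀ s ∈ Set.Icc s₀ s₁, s + (k + 1) * a - (ε + k * (ε / 2)) ≤ l₀ ∧
          l₁ ≤ s + (k + 1) * a + (ε + k * (ε / 2))) →
        (ε / 2) * (c * ∫ s in l₀..l₁, g (s : UnitAddCircle)) ≤
          ∫ s in s₀..s₁, (evolutionOp a ε)^[k + 1] g (s : UnitAddCircle) := by
      intro s₀ s₁ l₀ l₁ hs hl hsub
      have : ∫ _s in s₀..s₁, (c * ∫ s in l₀..l₁, g (s : UnitAddCircle)) =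
          (ε / 2) * (c * ∫ s in l₀..l₁, g (s : UnitAddCircle)) := by
        rw [intervalIntegral.integral_const, hs, smul_eq_mul]; ring
      rw [← this]
      refine intervalIntegral.integral_mono_on (by linarith) intervalIntegrable_const
        (hQ.intervalIntegrable _ _) fun s hs' => ?_
      refine le_trans ?_ (H g hg h0 s)
      gcongr
      exact intervalIntegral.integral_mono_interval (hsub s hs').1 hl (hsub s hs').2
        (ae_of_all _ fun s => h0 _) (hI _ _)
    have k1 := key (t + a - ε) (t + a - ε / 2) (y - r) y (by ring) (by linarith) fun s hs => by
      obtain ⟨h1, h2⟩ := hs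
      constructor <;> simp only [hy, hr] <;> linarith
    have k2 := key (t + a + ε / 2) (t + a + ε) y (y + r) (by ring) (by linarith) fun s hs => by
      obtain ⟨h1, h2⟩ := hs
      constructor <;> simp only [hy, hr] <;> linarith
    have k3 : 0 ≤ ∫ s in (t + a - ε / 2)..(t + a + ε / 2),
        (evolutionOp a ε)^[k + 1] g (s : UnitAddCircle) :=
      intervalIntegral.integral_nonneg (by linarith) fun s _ => hQ0 _
    rw [← intervalIntegral.integral_add_adjacent_intervals (hI (y - r) y) (hI y (y + r)),
      ← intervalIntegral.integral_add_adjacent_intervals (hQ.intervalIntegrable _ (t + a + ε / 2))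
        (hQ.intervalIntegrable _ _),
      ← intervalIntegral.integral_add_adjacent_intervals (hQ.intervalIntegrable _ (t + a - ε / 2))
        (hQ.intervalIntegrable _ _)]
    rw [inv_mul_eq_div, le_div_iff₀ (by positivity)]
    nlinarith

/-- Doeblin's minorization: some power of the transition kernel dominates a multiple of Lebesgue
measure. -/
theorem exists_doeblin (hε : 0 < ε) :
    ∃ m : ℕ, ∃ c : ℝ, 0 < m ∧ 0 < c ∧ ∀ g : UnitAddCircle → ℝ, BddMeas g → (∀ x, 0 ≤ g x) → ∀ x,
      c * ∫ y, g y ≤ (evolutionOp a ε)^[m] g x := by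
  obtain ⟨k, hk⟩ := exists_nat_ge (1 / ε)
  obtain ⟨c, hc, H⟩ := exists_mul_integral_le_evolutionOp_iterate (a := a) hε k
  refine ⟨k + 1, c, k.succ_pos, hc, fun g hg h0 x => ?_⟩
  induction x using QuotientAddGroup.induction_on with
  | H t =>
  refine le_trans ?_ (H g hg h0 t)
  rw [div_le_iff₀ hε] at hk
  gcongr
  rw [← UnitAddCircle.intervalIntegral_preimage (t + (k + 1) * a - 1 / 2)]
  exact intervalIntegral.integral_mono_interval (by linarith) (by linarith) (by linarith)
    (ae_of_all _ fun s => h0 _) (hg.intervalIntegrable _ _)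

end Evolution

/-! ### Uniform ergodicity -/

section Ergodicity

variable {a ε : ℝ} {μ : Measure UnitAddCircle} {g : UnitAddCircle → ℝ}

theorem IsStationary.integral_iterate (hμ : IsStationary a ε μ) (hε : 0 < ε) (hg : BddMeas g)
    (k : ℕ) : ∫ x, (evolutionOp a ε)^[k] g x ∂μ = ∫ x, g x ∂μ := by
  induction k with
  | zero => rfl
  | succ k ih =>
    have hk := hg.evolutionOp_iterate (a := a) hε k
    rw [Function.iterate_succ_apply', ← ih]
    exact hμ _ hk.1 hk.2

theorem volume_real_unitAddCircle : (volume : Measure UnitAddCircle).real Set.univ = 1 := by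
  simp [Measure.real]

/-- Under a minorization `Q^m g ≥ c ∫ g`, the power `Q^m` shrinks oscillations by `1 - c`. -/
theorem exists_evolutionOp_iterate_mem_Icc (hε : 0 < ε) {m : ℕ} {c : ℝ}
    (H : ∀ g : UnitAddCircle → ℝ, BddMeas g → (∀ x, 0 ≤ g x) → ∀ x,
      c * ∫ y, g y ≤ (evolutionOp a ε)^[m] g x) (k : ℕ) (hm : Measurable g) {b₀ b₁ : ℝ}
    (hg : ∀ x, g x ∈ Set.Icc b₀ b₁) :
    ∃ d₀ d₁ : ℝ, d₁ - d₀ ≤ (1 - c) ^ k * (b₁ - b₀) ∧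
      ∀ x, (evolutionOp a ε)^[m * k] g x ∈ Set.Icc d₀ d₁ := by
  induction k generalizing g b₀ b₁ with
  | zero => exact ⟨b₀, b₁, by simp, by simpa using hg⟩
  | succ k ih =>
    have hb := BddMeas.of_mem_Icc hm hg
    have hQ := hb.evolutionOp_iterate (a := a) hε m
    have hi := hb.integrable volume
    obtain ⟨d₀, d₁, hd, h⟩ := ih hQ.1 (b₀ := b₀ + c * (∫ y, g y - b₀))
        (b₁ := b₁ - c * (∫ y, b₁ - g y)) fun x => by
      have h1 := H (fun y => g y - b₀) (hb.sub (bddMeas_const _))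
        (fun y => sub_nonneg.2 (hg y).1) x
      have h2 := H (fun y => b₁ - g y) ((bddMeas_const _).sub hb)
        (fun y => sub_nonneg.2 (hg y).2) x
      rw [evolutionOp_iterate_sub hε hb (bddMeas_const _), evolutionOp_iterate_const hε] at h1
      rw [evolutionOp_iterate_sub hε (bddMeas_const _) hb, evolutionOp_iterate_const hε] at h2
      constructor <;> linarith
    refine ⟨d₀, d₁, hd.trans_eq ?_, fun x => ?_⟩
    · rw [integral_sub hi (integrable_const _), integral_sub (integrable_const _) hi]
      simp only [integral_const, volume_real_unitAddCircle, smul_eq_mul]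
      ring
    · rw [Nat.mul_succ, Function.iterate_add_apply]
      exact h x

/-- The two estimates on the random evolution on which everything rests: `Q^s g` approaches its
`μ`-mean uniformly at a geometric rate, and the transition kernel has a bounded density with respect
to `μ`. -/
theorem IsStationary.exists_bounds [IsProbabilityMeasure μ] (hμ : IsStationary a ε μ) (hε : 0 < ε) :
    ∃ (m : ℕ) (B ρ : ℝ), 0 < m ∧ 0 ≤ B ∧ 0 ≤ ρ ∧ ρ < 1 ∧
      (∀ g : UnitAddCircle → ℝ, Measurable g → (∀ x, g x ∈ Set.Icc (0 : ℝ) 1) → ∀ s x,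
        |(evolutionOp a ε)^[s] g x - ∫ y, g y ∂μ| ≤ ρ ^ (s / m)) ∧
      ∀ U : Set UnitAddCircle, MeasurableSet U → ∀ j x,
        (evolutionOp a ε)^[j + 1] (U.indicator 1) x ≤ B * μ.real U := by
  obtain ⟨m, c, hm, hc, H⟩ := exists_doeblin (a := a) hε
  have hc1 : c ≤ 1 := by
    have := H (fun _ => 1) (bddMeas_const 1) (fun _ => zero_le_one) 0
    rw [evolutionOp_iterate_const hε, integral_const, volume_real_unitAddCircle] at this
    simpa using this
  refine ⟨m, (2 * ε)⁻¹ * ⌈2 * ε⌉₊ / c, 1 - c, hm, by positivity, by linarith, by linarith, ?_, ?_⟩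
  · intro g hg h01 s x
    obtain ⟨d₀, d₁, hd, h⟩ := exists_evolutionOp_iterate_mem_Icc hε H (s / m) hg h01
    have hb := BddMeas.of_mem_Icc hg h01
    have hs : ∀ y, (evolutionOp a ε)^[s] g y ∈ Set.Icc d₀ d₁ := fun y => by
      have := evolutionOp_iterate_mem_Icc (a := a) hε (hb.evolutionOp_iterate hε _).1 h (s % m) y
      rwa [← Function.iterate_add_apply, Nat.mod_add_div] at this
    have hint : ∫ y, g y ∂μ ∈ Set.Icc d₀ d₁ := by
      have hi := (hb.evolutionOp_iterate (a := a) hε s).integrable μ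
      rw [← hμ.integral_iterate hε hb s]
      constructor
      · simpa using integral_mono (integrable_const d₀) hi fun y => (hs y).1
      · simpa using integral_mono hi (integrable_const d₁) fun y => (hs y).2
    have := abs_sub_le_of_le_of_le (hs x).1 (hs x).2 hint.1 hint.2
    linarith
  · intro U hU j x
    have hb := bddMeas_indicator_one hU
    have h0 : ∀ y, (0 : ℝ) ≤ U.indicator 1 y :=
      fun y => Set.indicator_nonneg (fun _ _ => zero_le_one) y
    -- Stationarity turns the minorization of the kernel into one of `μ`.
    have hvol : c * ∫ y, U.indicator 1 y ≤ μ.real U := by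
      have h1 := integral_mono (integrable_const _)
        ((hb.evolutionOp_iterate (a := a) hε m).integrable μ) (H _ hb h0)
      rw [hμ.integral_iterate hε hb, integral_indicator_one hU, integral_const,
        probReal_univ, one_smul] at h1
      rwa [integral_indicator_one hU] at h1 ⊢
    rw [Function.iterate_succ_apply]
    refine (evolutionOp_iterate_mem_Icc hε (hb.evolutionOp hε).1 (m := 0)
      (M := (2 * ε)⁻¹ * ⌈2 * ε⌉₊ * ∫ y, U.indicator 1 y) (fun y => ⟨?_, ?_⟩) j x).2.trans ?_
    · exact integral_nonneg fun w => h0 _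
    · exact evolutionOp_le hε hb h0 y
    · rw [div_mul_eq_mul_div, le_div_iff₀ hc, mul_assoc _ _ c, mul_comm _ c]
      gcongr

end Ergodicity

/-! ### The Markov property of the random orbit -/

/-- The skew product over the shift of the noise sequence: one random step. -/
def skew (a : ℝ) (p : UnitAddCircle × (ℕ → ℝ)) : UnitAddCircle × (ℕ → ℝ) :=
  (perturbed a (p.2 0) p.1, fun n => p.2 (n + 1))

theorem measurable_skew (a : ℝ) : Measurable (skew a) := by
  refine .prodMk ((measurable_perturbed a).comp (f := fun p : UnitAddCircle × (ℕ → ℝ) =>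
    (p.1, p.2 0)) (by fun_prop)) (by fun_prop)

theorem randomOrbit_add (a : ℝ) (s i : ℕ) (p : UnitAddCircle × (ℕ → ℝ)) :
    randomOrbit a (s + i) p.2 p.1 = randomOrbit a i ((skew a)^[s] p).2 ((skew a)^[s] p).1 := by
  have one : ∀ (i : ℕ) (p : UnitAddCircle × (ℕ → ℝ)),
      randomOrbit a (i + 1) p.2 p.1 = randomOrbit a i (skew a p).2 (skew a p).1 := by
    intro i p
    induction i with
    | zero => rfl
    | succ i ih => rw [randomOrbit, ih]; rfl
  induction s generalizing p with
  | zero => simp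
  | succ s ih => rw [Nat.add_right_comm, one, ih, Function.iterate_succ_apply]

theorem process_add (a : ℝ) (φ : UnitAddCircle → EReal) (s i : ℕ)
    (p : UnitAddCircle × (ℕ → ℝ)) :
    process a φ (s + i) p = process a φ i ((skew a)^[s] p) := by
  rw [process, randomOrbit_add, process]

theorem measurable_process (a : ℝ) {φ : UnitAddCircle → EReal} (hφ : Measurable φ) (n : ℕ) :
    Measurable (process a φ n) := by
  have : process a φ n = process a φ 0 ∘ (skew a)^[n] := funext fun p => process_add a φ n 0 p
  rw [this]
  exact (hφ.comp measurable_fst).comp ((measurable_skew a).iterate n)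

/-- The law of a noise sequence. -/
noncomputable def noiseSeq (ε : ℝ) : Measure (ℕ → ℝ) := Measure.infinitePi fun _ : ℕ => noise ε

theorem isProbabilityMeasure_noiseSeq {ε : ℝ} (hε : 0 < ε) :
    IsProbabilityMeasure (noiseSeq ε) := by
  have := isProbabilityMeasure_noise hε
  unfold noiseSeq
  infer_instance

/-- The first noise is independent of the later ones, which are distributed like the whole
sequence. -/
theorem measurePreserving_cons {ε : ℝ} (hε : 0 < ε) :
    MeasurePreserving (fun q : ℝ × (ℕ → ℝ) => fun n => Nat.casesOn n q.1 q.2)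
      ((noise ε).prod (noiseSeq ε)) (noiseSeq ε) := by
  have := isProbabilityMeasure_noise hε
  have := isProbabilityMeasure_noiseSeq hε
  have hm : Measurable (fun q : ℝ × (ℕ → ℝ) => fun n : ℕ =>
      (Nat.casesOn n q.1 q.2 : ℝ)) := by
    refine measurable_pi_lambda _ fun n => ?_
    cases n <;> simp only <;> fun_prop
  refine ⟨hm, ?_⟩
  refine Measure.eq_infinitePi _ fun I t ht => ?_
  classical
  -- Boxes over an initial segment of `ℕ` suffice, the added sides being `univ`.
  set t' : ℕ → Set ℝ := fun i => if i ∈ I then t i else Set.univ with ht'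
  have ht'm : ∀ i, MeasurableSet (t' i) := fun i => by
    simp only [ht']; split_ifs; exacts [ht i, .univ]
  obtain ⟨K, hK⟩ : ∃ K, I ⊆ Finset.range (K + 1) :=
    ⟨I.sup id, fun i hi => Finset.mem_range.2 (Nat.lt_succ_of_le (Finset.le_sup (f := id) hi))⟩
  have hpi : Set.pi (I : Set ℕ) t = Set.pi (Finset.range (K + 1) : Set ℕ) t' := by
    ext w
    simp only [Set.mem_pi, ht', Finset.mem_coe]
    constructor
    · intro h i _
      split_ifs with hi
      exacts [h i hi, trivial]
    · intro h i hi
      simpa [hi] using h i (hK hi)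
  have hprod : ∏ i ∈ I, noise ε (t i) = ∏ i ∈ Finset.range (K + 1), noise ε (t' i) := by
    rw [← Finset.prod_subset hK]
    · exact Finset.prod_congr rfl fun i hi => by simp [ht', hi]
    · intro i _ hi
      simp [ht', hi]
  have hpre : (fun q : ℝ × (ℕ → ℝ) => fun n : ℕ => (Nat.casesOn n q.1 q.2 : ℝ)) ⁻¹'
      Set.pi (Finset.range (K + 1) : Set ℕ) t' =
      t' 0 ×ˢ Set.pi (Finset.range K : Set ℕ) fun i => t' (i + 1) := by
    ext q
    simp only [Set.mem_preimage, Set.mem_pi, Finset.coe_range, Set.mem_Iio, Set.mem_prod]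
    constructor
    · exact fun h => ⟨h 0 K.succ_pos, fun i hi => h (i + 1) (Nat.succ_lt_succ hi)⟩
    · rintro ⟨h0, h1⟩ (_ | i) hi
      exacts [h0, h1 i (Nat.lt_of_succ_lt_succ hi)]
  rw [hpi, hprod, Measure.map_apply hm (.pi (Finset.countable_toSet _) fun i _ => ht'm i), hpre,
    Measure.prod_prod, noiseSeq, Measure.infinitePi_pi _ fun i _ => ht'm (i + 1),
    Finset.prod_range_succ', mul_comm]

section Markov

variable {a ε : ℝ}

/-- The conditional expectation of a functional of the orbit, given the initial point. -/
noncomputable def fiberMean (ε : ℝ) (F : UnitAddCircle × (ℕ → ℝ) → ℝ) (x : UnitAddCircle) : ℝ :=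
  ∫ w, F (x, w) ∂(noiseSeq ε)

theorem fiberMean_comp_skew (hε : 0 < ε) {F : UnitAddCircle × (ℕ → ℝ) → ℝ} (hF : BddMeas F) :
    fiberMean ε (F ∘ skew a) = evolutionOp a ε (fiberMean ε F) := by
  have := isProbabilityMeasure_noise hε
  have := isProbabilityMeasure_noiseSeq hε
  ext x
  have hFx : BddMeas fun w => (F ∘ skew a) (x, w) :=
    (hF.comp (measurable_skew a)).comp measurable_prodMk_left
  have hc := measurePreserving_cons hε
  rw [fiberMean, ← hc.map_eq, integral_map hc.measurable.aemeasurable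
    hFx.1.aestronglyMeasurable]
  refine integral_prod _ ?_
  exact (hFx.comp hc.measurable).integrable _

theorem fiberMean_comp_skew_iterate (hε : 0 < ε) {F : UnitAddCircle × (ℕ → ℝ) → ℝ}
    (hF : BddMeas F) (s : ℕ) :
    fiberMean ε (F ∘ (skew a)^[s]) = (evolutionOp a ε)^[s] (fiberMean ε F) := by
  induction s with
  | zero => rfl
  | succ s ih =>
    rw [Function.iterate_succ, ← Function.comp_assoc,
      fiberMean_comp_skew hε (hF.comp ((measurable_skew a).iterate s)), ih,
      Function.iterate_succ_apply']

theorem orbitMeasure_real_fst (hε : 0 < ε) {μ : Measure UnitAddCircle} (U : Set UnitAddCircle) :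
    (orbitMeasure ε μ).real {p | p.1 ∈ U} = μ.real U := by
  have := isProbabilityMeasure_noiseSeq hε
  have h : {p : UnitAddCircle × (ℕ → ℝ) | p.1 ∈ U} = U ×ˢ Set.univ := by ext; simp
  have h2 := measureReal_prod_prod (μ := μ) (ν := noiseSeq ε) U Set.univ
  rw [probReal_univ, mul_one] at h2
  rw [h, ← h2]
  rfl

variable {μ : Measure UnitAddCircle} [IsProbabilityMeasure μ]

theorem isProbabilityMeasure_orbitMeasure (hε : 0 < ε) :
    IsProbabilityMeasure (orbitMeasure ε μ) := by
  have := isProbabilityMeasure_noiseSeq hε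
  exact inferInstanceAs (IsProbabilityMeasure (μ.prod (noiseSeq ε)))

/-- The Markov property: after `s` steps, an event `A` concerning the future orbit is seen through
`Q^s` applied to its conditional probability. -/
theorem orbitMeasure_real_inter_skew (hε : 0 < ε) {U : Set UnitAddCircle} (hU : MeasurableSet U)
    {A : Set (UnitAddCircle × (ℕ → ℝ))} (hA : MeasurableSet A) (s : ℕ) :
    (orbitMeasure ε μ).real {p | p.1 ∈ U ∧ (skew a)^[s] p ∈ A} =
      ∫ x in U, (evolutionOp a ε)^[s] (fiberMean ε (A.indicator 1)) x ∂μ := by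
  have := isProbabilityMeasure_noiseSeq hε
  have hs := (measurable_skew a).iterate s
  have hbA := bddMeas_indicator_one hA
  have hm : MeasurableSet {p : UnitAddCircle × (ℕ → ℝ) | p.1 ∈ U ∧ (skew a)^[s] p ∈ A} :=
    (measurable_fst hU).inter (hs hA)
  rw [← integral_indicator_one hm, ← fiberMean_comp_skew_iterate hε hbA,
    ← integral_indicator hU]
  refine (integral_prod (μ := μ) (ν := noiseSeq ε) _
    ((bddMeas_indicator_one hm).integrable _)).trans ?_
  refine integral_congr_ae (ae_of_all _ fun x => ?_)
  by_cases hx : x ∈ U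
  · rw [Set.indicator_of_mem hx, fiberMean]
    refine integral_congr_ae (ae_of_all _ fun w => ?_)
    classical simp [Set.indicator_apply, hx]
  · rw [Set.indicator_of_notMem hx]
    simp [hx]

theorem fiberMean_indicator_mem_Icc (hε : 0 < ε) {A : Set (UnitAddCircle × (ℕ → ℝ))}
    (hA : MeasurableSet A) (x : UnitAddCircle) :
    fiberMean ε (A.indicator 1) x ∈ Set.Icc (0 : ℝ) 1 := by
  have := isProbabilityMeasure_noiseSeq hε
  have : fiberMean ε (A.indicator 1) x = (noiseSeq ε).real (Prod.mk x ⁻¹' A) := by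
    rw [← integral_indicator_one (measurable_prodMk_left hA)]
    rfl
  rw [this]
  exact ⟨measureReal_nonneg, measureReal_le_one⟩

theorem measurable_fiberMean_indicator (hε : 0 < ε) {A : Set (UnitAddCircle × (ℕ → ℝ))}
    (hA : MeasurableSet A) : Measurable (fiberMean ε (A.indicator 1)) := by
  have := isProbabilityMeasure_noiseSeq hε
  exact ((bddMeas_indicator_one hA).integral_prod_right (noiseSeq ε)).1

theorem integral_fiberMean_indicator (hε : 0 < ε) {A : Set (UnitAddCircle × (ℕ → ℝ))}
    (hA : MeasurableSet A) :
    ∫ x, fiberMean ε (A.indicator 1) x ∂μ = (orbitMeasure ε μ).real A := by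
  simpa using (orbitMeasure_real_inter_skew (a := 0) (μ := μ) hε .univ hA 0).symm

/-- The orbit measure is invariant under the skew product. -/
theorem IsStationary.orbitMeasure_real_skew (hμ : IsStationary a ε μ) (hε : 0 < ε)
    {A : Set (UnitAddCircle × (ℕ → ℝ))} (hA : MeasurableSet A) :
    (orbitMeasure ε μ).real {p | skew a p ∈ A} = (orbitMeasure ε μ).real A := by
  have h := orbitMeasure_real_inter_skew (a := a) (μ := μ) hε .univ hA 1
  rw [Measure.restrict_univ, hμ.integral_iterate hε (.of_mem_Icc
    (measurable_fiberMean_indicator hε hA) (fiberMean_indicator_mem_Icc hε hA)),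
    integral_fiberMean_indicator hε hA] at h
  simpa using h

/-- Quantitative mixing: an event about the initial point decorrelates from the orbit after `s`
steps at the geometric rate `ρ ^ (s / m)`, and a return to `U` at a positive time is, up to the
constant `B`, at most as likely as if it were independent of the start. -/
structure MixingBounds (a ε : ℝ) (μ : Measure UnitAddCircle) (m : ℕ) (B ρ : ℝ) : Prop where
  pos : 0 < m
  nonneg : 0 ≤ B
  rate_nonneg : 0 ≤ ρ
  rate_lt_one : ρ < 1
  decorrelation : ∀ U : Set UnitAddCircle, MeasurableSet U →
    ∀ A : Set (UnitAddCircle × (ℕ → ℝ)), MeasurableSet A → ∀ s,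
      |(orbitMeasure ε μ).real {p | p.1 ∈ U ∧ (skew a)^[s] p ∈ A} -
        μ.real U * (orbitMeasure ε μ).real A| ≤ μ.real U * ρ ^ (s / m)
  return_le : ∀ U : Set UnitAddCircle, MeasurableSet U → ∀ j,
    (orbitMeasure ε μ).real {p | p.1 ∈ U ∧ ((skew a)^[j + 1] p).1 ∈ U} ≤ B * μ.real U ^ 2

theorem IsStationary.exists_mixingBounds (hμ : IsStationary a ε μ) (hε : 0 < ε) :
    ∃ (m : ℕ) (B ρ : ℝ), MixingBounds a ε μ m B ρ := by
  have := isProbabilityMeasure_noiseSeq hε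
  obtain ⟨m, B, ρ, hm, hB, hρ0, hρ1, h1, h2⟩ := hμ.exists_bounds hε
  refine ⟨m, B, ρ, hm, hB, hρ0, hρ1, fun U hU A hA s => ?_, fun U hU j => ?_⟩
  · have hg := measurable_fiberMean_indicator hε hA
    have hg01 := fiberMean_indicator_mem_Icc hε hA
    have hi := ((BddMeas.of_mem_Icc hg hg01).evolutionOp_iterate (a := a) hε s).integrable
      (μ.restrict U)
    rw [orbitMeasure_real_inter_skew hε hU hA]
    have hc : μ.real U * (orbitMeasure ε μ).real A =
        ∫ _ in U, (orbitMeasure ε μ).real A ∂μ := by simp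
    rw [hc, ← integral_sub hi (integrable_const _)]
    have := norm_integral_le_of_norm_le_const (μ := μ.restrict U)
      (f := fun x => (evolutionOp a ε)^[s] (fiberMean ε (A.indicator 1)) x -
        (orbitMeasure ε μ).real A) (C := ρ ^ (s / m)) (ae_of_all _ fun x => by
          rw [← integral_fiberMean_indicator hε hA]
          exact h1 _ hg hg01 s x)
    rw [measureReal_restrict_apply_univ, mul_comm] at this
    exact this
  · have hA : MeasurableSet (Prod.fst ⁻¹' U : Set (UnitAddCircle × (ℕ → ℝ))) := measurable_fst hU
    have hf : fiberMean ε ((Prod.fst ⁻¹' U : Set (UnitAddCircle × (ℕ → ℝ))).indicator 1) =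
        U.indicator 1 := by
      ext x
      rw [fiberMean]
      by_cases hx : x ∈ U <;> simp [hx]
    have key := orbitMeasure_real_inter_skew (a := a) (μ := μ) hε hU hA (j + 1)
    refine key.trans_le ?_
    rw [hf]
    refine (integral_mono (((bddMeas_indicator_one hU).evolutionOp_iterate hε _).integrable _)
      (integrable_const (B * μ.real U)) fun x => h2 U hU j x).trans_eq ?_
    rw [integral_const, measureReal_restrict_apply_univ, smul_eq_mul]
    ring

end Markov

/-! ### Exceedances along the random orbit -/

section Exceedance

variable {a ε : ℝ} {φ : UnitAddCircle → EReal}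

theorem partialMax_le_iff {n : ℕ} {p : UnitAddCircle × (ℕ → ℝ)} {c : EReal} :
    partialMax (process a φ) n p ≤ c ↔ ∀ i < n, process a φ i p ≤ c := by
  simp [partialMax]

theorem windowMax_eq (s l : ℕ) (p : UnitAddCircle × (ℕ → ℝ)) :
    windowMax (process a φ) s l p = partialMax (process a φ) l ((skew a)^[s] p) := by
  simp only [windowMax, partialMax, process_add]

theorem measurableSet_partialMax_le (hφ : Measurable φ) (n : ℕ) (c : EReal) :
    MeasurableSet {p | partialMax (process a φ) n p ≤ c} := by
  have : {p | partialMax (process a φ) n p ≤ c} =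
      ⋂ i, ⋂ (_ : i < n), {p | process a φ i p ≤ c} := by
    ext p
    simp [partialMax_le_iff]
  rw [this]
  exact .iInter fun i => .iInter fun _ => measurableSet_le (measurable_process a hφ i)
    measurable_const

theorem measurableSet_exceedance (hφ : Measurable φ) (c : EReal) :
    MeasurableSet {x | c < φ x} := measurableSet_lt measurable_const hφ

theorem real_exceedance_zero (hε : 0 < ε) {μ : Measure UnitAddCircle} (c : EReal) :
    (orbitMeasure ε μ).real {p | c < process a φ 0 p} = μ.real {x | c < φ x} :=
  orbitMeasure_real_fst hε {x | c < φ x}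

variable {μ : Measure UnitAddCircle} {m : ℕ} {B ρ : ℝ}

theorem MixingBounds.windowMax_sub_le (h : MixingBounds a ε μ m B ρ) (hε : 0 < ε)
    (hφ : Measurable φ) (c : EReal) (s l : ℕ) :
    |(orbitMeasure ε μ).real {p | c < process a φ 0 p ∧ windowMax (process a φ) s l p ≤ c} -
      (orbitMeasure ε μ).real {p | c < process a φ 0 p} *
        (orbitMeasure ε μ).real {p | partialMax (process a φ) l p ≤ c}| ≤
      μ.real {x | c < φ x} * ρ ^ (s / m) := by
  have := h.decorrelation _ (measurableSet_exceedance hφ c) _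
    (measurableSet_partialMax_le (a := a) hφ l c) s
  rw [real_exceedance_zero hε]
  simp only [windowMax_eq]
  exact this

theorem MixingBounds.process_succ_le (h : MixingBounds a ε μ m B ρ)
    (hφ : Measurable φ) (c : EReal) (j : ℕ) :
    (orbitMeasure ε μ).real {p | c < process a φ 0 p ∧ c < process a φ (j + 1) p} ≤
      B * μ.real {x | c < φ x} ^ 2 := by
  have hj : ∀ p, process a φ (j + 1) p = process a φ 0 ((skew a)^[j + 1] p) :=
    process_add a φ (j + 1) 0
  simp only [hj]
  exact h.return_le _ (measurableSet_exceedance hφ c) j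

variable [IsProbabilityMeasure μ]

/-- Replacing the window starting at time `1` by the one starting at time `s`, after an exceedance at
time `0`, changes the probability by that of an exceedance at one of at most `s` positive times. -/
theorem MixingBounds.abs_windowMax_one_sub_le (h : MixingBounds a ε μ m B ρ) (hε : 0 < ε)
    (hφ : Measurable φ) (c : EReal) {s : ℕ} (hs : 1 ≤ s) (l : ℕ) :
    |(orbitMeasure ε μ).real {p | c < process a φ 0 p ∧ windowMax (process a φ) 1 l p ≤ c} -
      (orbitMeasure ε μ).real {p | c < process a φ 0 p ∧ windowMax (process a φ) s l p ≤ c}| ≤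
      s * (B * μ.real {x | c < φ x} ^ 2) := by
  have := isProbabilityMeasure_orbitMeasure (μ := μ) hε
  have hw : ∀ r p, windowMax (process a φ) r l p ≤ c ↔ ∀ i < l, process a φ (r + i) p ≤ c := by
    simp [windowMax]
  have bound : ∀ r, (orbitMeasure ε μ).real (⋃ i ∈ Finset.range s,
      {p | c < process a φ 0 p ∧ c < process a φ (r + i + 1) p}) ≤
      s * (B * μ.real {x | c < φ x} ^ 2) := fun r => by
    refine (measureReal_biUnion_finset_le _ _).trans ?_
    refine (Finset.sum_le_sum fun i _ => h.process_succ_le hφ c (r + i)).trans_eq ?_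
    simp
  have comparison : ∀ E F G : Set (UnitAddCircle × (ℕ → ℝ)), E ⊆ F ∪ G →
      (orbitMeasure ε μ).real E ≤ (orbitMeasure ε μ).real F + (orbitMeasure ε μ).real G :=
    fun E F G hE => (measureReal_mono hE).trans (measureReal_union_le F G)
  rw [abs_sub_le_iff, sub_le_iff_le_add', sub_le_iff_le_add']
  constructor
  · refine (comparison _ _ (⋃ i ∈ Finset.range s,
      {p | c < process a φ 0 p ∧ c < process a φ (l + i + 1) p}) fun p hp => ?_).trans
        (add_le_add_right (bound l) _)
    by_cases hF : windowMax (process a φ) s l p ≤ c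
    · exact Or.inl ⟨hp.1, hF⟩
    have hE := (hw 1 p).1 hp.2
    simp only [hw, not_forall, not_le] at hF
    obtain ⟨i, hi, hlt⟩ := hF
    -- An exceedance in the second window only happens after the end of the first one.
    have hil : l < s + i := by
      by_contra hle
      have := hE (s + i - 1) (by omega)
      rw [show 1 + (s + i - 1) = s + i by omega] at this
      exact this.not_gt hlt
    refine Or.inr (Set.mem_biUnion (x := s + i - l - 1)
      (Finset.mem_coe.2 (Finset.mem_range.2 (by omega))) ⟨hp.1, ?_⟩)
    rwa [show l + (s + i - l - 1) + 1 = s + i by omega]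
  · refine (comparison _ _ (⋃ i ∈ Finset.range s,
      {p | c < process a φ 0 p ∧ c < process a φ (0 + i + 1) p}) fun p hp => ?_).trans
        (add_le_add_right (bound 0) _)
    by_cases hE : windowMax (process a φ) 1 l p ≤ c
    · exact Or.inl ⟨hp.1, hE⟩
    have hF := (hw s p).1 hp.2
    simp only [hw, not_forall, not_le] at hE
    obtain ⟨i, hi, hlt⟩ := hE
    -- An exceedance in the first window only happens before the start of the second one.
    have his : i < s := by
      by_contra hle
      have := hF (1 + i - s) (by omega)
      rw [show s + (1 + i - s) = 1 + i by omega] at this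
      exact this.not_gt hlt
    refine Or.inr (Set.mem_biUnion (x := i)
      (Finset.mem_coe.2 (Finset.mem_range.2 his)) ⟨hp.1, ?_⟩)
    rwa [show 0 + i + 1 = 1 + i by omega]

/-- Either the first observation exceeds the level or the maximum of `l + 1` observations is decided
by the remaining `l`. -/
theorem IsStationary.partialMax_succ_add (hμ : IsStationary a ε μ) (hε : 0 < ε)
    (hφ : Measurable φ) (c : EReal) (l : ℕ) :
    (orbitMeasure ε μ).real {p | partialMax (process a φ) (l + 1) p ≤ c} +
      (orbitMeasure ε μ).real {p | c < process a φ 0 p ∧ windowMax (process a φ) 1 l p ≤ c} =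
      (orbitMeasure ε μ).real {p | partialMax (process a φ) l p ≤ c} := by
  have := isProbabilityMeasure_orbitMeasure (μ := μ) hε
  have hA := measurableSet_partialMax_le (a := a) hφ l c
  have hU : MeasurableSet {p | c < process a φ 0 p} :=
    measurableSet_lt measurable_const (measurable_process a hφ 0)
  rw [← hμ.orbitMeasure_real_skew hε hA,
    ← measureReal_sdiff_add_inter (s := {p | skew a p ∈ {p | partialMax (process a φ) l p ≤ c}}) hU]
  congr 2
  · ext p
    have : ∀ i, process a φ (i + 1) p = process a φ i (skew a p) := fun i => by
      rw [add_comm, process_add]; rfl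
    simp only [Set.mem_ofPred_eq, Set.mem_sdiff, partialMax_le_iff, not_lt, ← this]
    constructor
    · exact fun H => ⟨fun i hi => H (i + 1) (by omega), H 0 (by omega)⟩
    · rintro ⟨H, H0⟩ (_ | i) hi
      exacts [H0, H i (by omega)]
  · ext p
    simp only [Set.mem_ofPred_eq, Set.mem_inter_iff, windowMax_eq]
    exact and_comm

/-- The maximum of `n` observations behaves like that of `n` independent ones, the error being
controlled by the mixing bounds with an arbitrary gap `s`. -/
theorem MixingBounds.abs_partialMax_sub_pow_le (h : MixingBounds a ε μ m B ρ)
    (hμ : IsStationary a ε μ) (hε : 0 < ε) (hφ : Measurable φ) (c : EReal) {s : ℕ} (hs : 1 ≤ s)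
    (n : ℕ) :
    |(orbitMeasure ε μ).real {p | partialMax (process a φ) n p ≤ c} -
      (1 - μ.real {x | c < φ x}) ^ n| ≤
      n * (s * (B * μ.real {x | c < φ x} ^ 2) + μ.real {x | c < φ x} * ρ ^ (s / m)) := by
  have := isProbabilityMeasure_orbitMeasure (μ := μ) hε
  induction n with
  | zero =>
    have : {p | partialMax (process a φ) 0 p ≤ c} = Set.univ := by ext p; simp [partialMax]
    simp [this]
  | succ l ih =>
    have h1 := h.abs_windowMax_one_sub_le hε hφ c hs l
    have h2 := h.windowMax_sub_le hε hφ c s l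
    have h3 := hμ.partialMax_succ_add hε hφ c l
    rw [real_exceedance_zero hε] at h2
    set b := μ.real {x | c < φ x}
    set x := (orbitMeasure ε μ).real {p | partialMax (process a φ) l p ≤ c}
    set δ := s * (B * b ^ 2) + b * ρ ^ (s / m)
    have hb0 : 0 ≤ b := measureReal_nonneg
    have hb1 : b ≤ 1 := measureReal_le_one
    have h4 : |(1 - b) * (x - (1 - b) ^ l)| ≤ l * δ := by
      rw [abs_mul, abs_of_nonneg (sub_nonneg.2 hb1)]
      exact (mul_le_of_le_one_left (abs_nonneg _) (by linarith)).trans ih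
    rw [← eq_sub_iff_add_eq] at h3
    rw [h3, pow_succ]
    push_cast
    rw [abs_le] at *
    constructor <;> linarith

end Exceedance

/-! ### Asymptotics -/

section Asymptotics

theorem tendsto_nat_sqrt : Tendsto Nat.sqrt atTop atTop :=
  tendsto_atTop_atTop.2 fun b => ⟨b * b, fun _ hn => Nat.le_sqrt.2 hn⟩

theorem tendsto_sqrt_div : Tendsto (fun n : ℕ => (Nat.sqrt n : ℝ) / n) atTop (𝓝 0) := by
  have h : Tendsto (fun n : ℕ => ((Nat.sqrt n : ℝ))⁻¹) atTop (𝓝 0) :=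
    tendsto_inv_atTop_zero.comp (tendsto_natCast_atTop_atTop.comp tendsto_nat_sqrt)
  refine squeeze_zero' (Eventually.of_forall fun n => by positivity) ?_ h
  filter_upwards [eventually_ge_atTop 1] with n hn
  have hs : 0 < (Nat.sqrt n : ℝ) := by exact_mod_cast Nat.sqrt_pos.2 hn
  rw [div_le_iff₀ (by exact_mod_cast hn), inv_mul_eq_div, le_div_iff₀ hs]
  exact_mod_cast Nat.sqrt_le n

theorem tendsto_sqrt_sqrt_mul_sqrt_div :
    Tendsto (fun n : ℕ => (Nat.sqrt (Nat.sqrt n) : ℝ) * Nat.sqrt n / n) atTop (𝓝 0) := by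
  refine squeeze_zero' (Eventually.of_forall fun n => by positivity) ?_
    (tendsto_sqrt_div.comp tendsto_nat_sqrt)
  filter_upwards [eventually_ge_atTop 1] with n hn
  have hs : 0 < (Nat.sqrt n : ℝ) := by exact_mod_cast Nat.sqrt_pos.2 hn
  have hsq : (Nat.sqrt n : ℝ) * Nat.sqrt n ≤ n := by exact_mod_cast Nat.sqrt_le n
  simp only [Function.comp_apply]
  rw [div_le_div_iff₀ (by exact_mod_cast hn) hs, mul_assoc]
  gcongr

theorem isLittleO_natCast_of_tendsto_div {f : ℕ → ℝ}
    (h : Tendsto (fun n => f n / n) atTop (𝓝 0)) : f =o[atTop] (fun n : ℕ => (n : ℝ)) := by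
  refine (Asymptotics.isLittleO_iff_tendsto' ?_).2 h
  filter_upwards [eventually_ge_atTop 1] with n hn h0
  exact absurd h0 (by positivity)

theorem tendsto_pow_sqrt_div {ρ : ℝ} (h0 : 0 ≤ ρ) (h1 : ρ < 1) {m : ℕ} (hm : 0 < m) :
    Tendsto (fun n : ℕ => ρ ^ (Nat.sqrt n / m)) atTop (𝓝 0) :=
  (tendsto_pow_atTop_nhds_zero_of_lt_one h0 h1).comp
    ((Nat.tendsto_div_const_atTop hm.ne').comp tendsto_nat_sqrt)

variable {a ε : ℝ} {φ : UnitAddCircle → EReal} {μ : Measure UnitAddCircle}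
  {m : ℕ} {B ρ : ℝ} {v : ℕ → ℝ} {σ : ℝ}

/-- The Poisson limit for maxima: levels with `σ` expected exceedances are not exceeded with
probability tending to `exp (-σ)`. -/
theorem MixingBounds.tendsto_partialMax [IsProbabilityMeasure μ] (h : MixingBounds a ε μ m B ρ)
    (hμ : IsStationary a ε μ) (hε : 0 < ε) (hφ : Measurable φ)
    (hv : Tendsto (fun n : ℕ => (n : ℝ) * μ.real {x | (v n : EReal) < φ x}) atTop (𝓝 σ)) :
    Tendsto (fun n : ℕ => (orbitMeasure ε μ).real
      {p | partialMax (process a φ) n p ≤ (v n : EReal)}) atTop (𝓝 (Real.exp (-σ))) := by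
  set b : ℕ → ℝ := fun n => μ.real {x | (v n : EReal) < φ x} with hb
  have hpow : Tendsto (fun n : ℕ => (1 - b n) ^ n) atTop (𝓝 (Real.exp (-σ))) := by
    have := Real.tendsto_one_add_pow_exp_of_tendsto (g := fun n => -b n) (t := -σ)
      (by simpa using hv.neg)
    simpa only [← sub_eq_add_neg] using this
  have herr : Tendsto (fun n : ℕ => (n : ℝ) * (Nat.sqrt n * (B * b n ^ 2) +
      b n * ρ ^ (Nat.sqrt n / m))) atTop (𝓝 0) := by
    have := ((hv.pow 2).const_mul B).mul tendsto_sqrt_div |>.add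
      (hv.mul (tendsto_pow_sqrt_div h.rate_nonneg h.rate_lt_one h.pos))
    simp only [mul_zero, add_zero] at this
    refine this.congr fun n => ?_
    rcases eq_or_ne n 0 with rfl | hn
    · simp
    · field_simp
      simp only [hb]
      ring
  have hdiff : Tendsto (fun n : ℕ => (orbitMeasure ε μ).real
      {p | partialMax (process a φ) n p ≤ (v n : EReal)} - (1 - b n) ^ n) atTop (𝓝 0) := by
    refine squeeze_zero_norm' ?_ herr
    filter_upwards [eventually_ge_atTop 1] with n hn
    exact h.abs_partialMax_sub_pow_le hμ hε hφ (v n) (Nat.sqrt_pos.2 hn) n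
  simpa using hdiff.add hpow

theorem MixingBounds.condD2With (h : MixingBounds a ε μ m B ρ) (hε : 0 < ε) (hφ : Measurable φ)
    (hv : Tendsto (fun n : ℕ => (n : ℝ) * μ.real {x | (v n : EReal) < φ x}) atTop (𝓝 σ)) :
    CondD2With (orbitMeasure ε μ) (process a φ) v Nat.sqrt := by
  refine ⟨isLittleO_natCast_of_tendsto_div tendsto_sqrt_div,
    fun n s => μ.real {x | (v n : EReal) < φ x} * ρ ^ (s / m), fun n s s' hs => ?_,
    fun l s n => h.windowMax_sub_le hε hφ (v n) s l, ?_⟩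
  · exact mul_le_mul_of_nonneg_left (pow_le_pow_of_le_one h.rate_nonneg h.rate_lt_one.le
      (Nat.div_le_div_right hs)) measureReal_nonneg
  · have := hv.mul (tendsto_pow_sqrt_div h.rate_nonneg h.rate_lt_one h.pos)
    simpa only [mul_zero, mul_assoc] using this

theorem MixingBounds.condDPrimeWith (h : MixingBounds a ε μ m B ρ) (hφ : Measurable φ)
    (hv : Tendsto (fun n : ℕ => (n : ℝ) * μ.real {x | (v n : EReal) < φ x}) atTop (𝓝 σ)) :
    CondDPrimeWith (orbitMeasure ε μ) (process a φ) v Nat.sqrt := by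
  have hk := tendsto_nat_sqrt.comp tendsto_nat_sqrt
  refine ⟨fun n => Nat.sqrt (Nat.sqrt n), hk,
    isLittleO_natCast_of_tendsto_div tendsto_sqrt_sqrt_mul_sqrt_div, ?_⟩
  have hlim := ((hv.pow 2).const_mul B).mul
    (tendsto_inv_atTop_zero.comp (tendsto_natCast_atTop_atTop.comp hk))
  rw [mul_zero] at hlim
  refine squeeze_zero (fun n => mul_nonneg n.cast_nonneg
    (Finset.sum_nonneg fun _ _ => measureReal_nonneg)) (fun n => ?_) hlim
  have hsum : ∑ j ∈ Finset.Icc 1 (n / Nat.sqrt (Nat.sqrt n)), (orbitMeasure ε μ).real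
      {p | (v n : EReal) < process a φ 0 p ∧ (v n : EReal) < process a φ j p} ≤
      (n / Nat.sqrt (Nat.sqrt n) : ℕ) * (B * μ.real {x | (v n : EReal) < φ x} ^ 2) := by
    refine (Finset.sum_le_card_nsmul _ _ (B * μ.real {x | (v n : EReal) < φ x} ^ 2)
      fun j hj => ?_).trans_eq (by simp)
    obtain ⟨i, rfl⟩ := Nat.exists_eq_succ_of_ne_zero
      (Nat.one_le_iff_ne_zero.1 (Finset.mem_Icc.1 hj).1)
    exact h.process_succ_le hφ (v n) i
  have hdiv : ((n / Nat.sqrt (Nat.sqrt n) : ℕ) : ℝ) ≤ n * (Nat.sqrt (Nat.sqrt n) : ℝ)⁻¹ :=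
    Nat.cast_div_le
  have hB : 0 ≤ B * μ.real {x | (v n : EReal) < φ x} ^ 2 := mul_nonneg h.nonneg (sq_nonneg _)
  calc _ ≤ (n : ℝ) * (n * (Nat.sqrt (Nat.sqrt n) : ℝ)⁻¹ *
        (B * μ.real {x | (v n : EReal) < φ x} ^ 2)) := by
        gcongr
        exact hsum.trans (mul_le_mul_of_nonneg_right hdiv hB)
    _ = _ := by simp only [Function.comp_apply]; ring

end Asymptotics

/-! ### The extreme value law -/

/-- The exponential distribution function, written so as to be visibly continuous. -/
noncomputable def expDistribution (x : ℝ) : ℝ := 1 - Real.exp (-max x 0)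

theorem continuous_expDistribution : Continuous expDistribution := by
  unfold expDistribution
  fun_prop

theorem isDistributionFunction_expDistribution : IsDistributionFunction expDistribution where
  mono x y hxy := by
    unfold expDistribution
    gcongr
  right_cts x := continuous_expDistribution.continuousWithinAt
  tendsto_bot := by
    refine tendsto_const_nhds.congr' ?_
    filter_upwards [eventually_le_atBot 0] with x hx
    simp [expDistribution, hx]
  tendsto_top := by
    have : Tendsto (fun x : ℝ => 1 - Real.exp (-x)) atTop (𝓝 (1 - 0)) :=
      tendsto_const_nhds.sub Real.tendsto_exp_neg_atTop_nhds_zero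
    rw [sub_zero] at this
    refine this.congr' ?_
    filter_upwards [eventually_ge_atTop 0] with x hx
    simp [expDistribution, hx]

theorem one_sub_expDistribution {x : ℝ} (hx : 0 ≤ x) :
    1 - expDistribution x = Real.exp (-x) := by
  simp [expDistribution, hx]

/-- Levels for intensity `σ` are obtained from levels for intensity `τ` by the change of index
`n ↦ ⌊nσ⁻¹τ⌋`. -/
theorem exists_levels_of_levels {b : ℝ → ℝ} {u : ℕ → ℝ} {τ σ : ℝ} (hτ : 0 < τ) (hσ : 0 < σ)
    (hu : Tendsto (fun n : ℕ => (n : ℝ) * b (u n)) atTop (𝓝 τ)) :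
    ∃ v : ℕ → ℝ, Tendsto (fun n : ℕ => (n : ℝ) * b (v n)) atTop (𝓝 σ) := by
  have hr : 0 < τ / σ := div_pos hτ hσ
  set k : ℕ → ℕ := fun n => ⌊τ / σ * n⌋₊ with hk
  have hkt : Tendsto k atTop atTop :=
    tendsto_nat_floor_atTop.comp (tendsto_natCast_atTop_atTop.const_mul_atTop hr)
  have h1 : Tendsto (fun n : ℕ => (k n : ℝ) / n) atTop (𝓝 (τ / σ)) :=
    (tendsto_nat_floor_mul_div_atTop hr.le).comp tendsto_natCast_atTop_atTop
  have h2 := (h1.inv₀ hr.ne').mul (hu.comp hkt)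
  rw [inv_div, div_mul_cancel₀ _ hτ.ne'] at h2
  refine ⟨fun n => u (k n), h2.congr' ?_⟩
  filter_upwards [hkt.eventually_ge_atTop 1] with n hn
  have : (k n : ℝ) ≠ 0 := by positivity
  simp only [Function.comp_apply]
  field_simp

end ExtremeValue

theorem mainTheorem1 (α ε : ℝ) (hε : 0 < ε)
    (μ : Measure UnitAddCircle) [IsProbabilityMeasure μ] (hμ : ExtremeValue.IsStationary α ε μ)
    (φ : UnitAddCircle → EReal) (hφ : Measurable φ) (hφbot : ∀ x, φ x ≠ ⊥)
    (z : UnitAddCircle) (τ : ℝ) (hτ : 0 < τ) (u : ℕ → ℝ)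
    (hu : Tendsto (fun n : ℕ => (n : ℝ) * (ExtremeValue.orbitMeasure ε μ).real
      {p | (u n : EReal) < ExtremeValue.process α φ 0 p}) atTop (𝓝 τ))
    (hz : ⋂ n : ℕ, {x | (u n : EReal) < φ x} = {z}) :
    (∃ t : ℕ → ℕ,
      ExtremeValue.CondD2With (ExtremeValue.orbitMeasure ε μ) (ExtremeValue.process α φ) u t ∧
      ExtremeValue.CondDPrimeWith (ExtremeValue.orbitMeasure ε μ) (ExtremeValue.process α φ) u t) ∧
    Tendsto (fun n : ℕ => (ExtremeValue.orbitMeasure ε μ).real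
      {p | ExtremeValue.partialMax (ExtremeValue.process α φ) n p ≤ (u n : EReal)})
      atTop (𝓝 (Real.exp (-τ))) ∧
    ExtremeValue.HasExtremalIndex (ExtremeValue.orbitMeasure ε μ) (ExtremeValue.process α φ) 1 := by
  obtain ⟨m, B, ρ, h⟩ := hμ.exists_mixingBounds hε
  have hP : ∀ c : EReal, (ExtremeValue.orbitMeasure ε μ).real
      {p | c < ExtremeValue.process α φ 0 p} = μ.real {x | c < φ x} :=
    ExtremeValue.real_exceedance_zero hε
  simp only [hP] at hu
  refine ⟨⟨Nat.sqrt, h.condD2With hε hφ hu, h.condDPrimeWith hφ hu⟩,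
    h.tendsto_partialMax hμ hε hφ hu, zero_le_one, le_rfl, ExtremeValue.expDistribution,
    ⟨ExtremeValue.isDistributionFunction_expDistribution, ⟨1, ?_, ?_⟩, ?_, fun σ hσ => ?_⟩,
    fun σ hσ => ?_⟩
  · simp [ExtremeValue.expDistribution]
  · simpa [ExtremeValue.expDistribution] using Real.exp_pos (-1)
  · simp [ExtremeValue.expDistribution]
  · obtain ⟨v, hv⟩ := ExtremeValue.exists_levels_of_levels
      (b := fun c => μ.real {x | (c : EReal) < φ x}) hτ hσ hu
    refine ⟨v, by simpa only [hP] using hv, fun _ => ?_⟩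
    rw [ExtremeValue.one_sub_expDistribution hσ.le]
    exact h.tendsto_partialMax hμ hε hφ hv
  · rw [one_mul, ExtremeValue.one_sub_expDistribution hσ.le]
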